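/- Three parties share a quantum state $\rho$ (a density operator) on $\mathbb{C}^{d_1}\otimes\mathbb{C}^{d_2}\otimes\mathbb{C}^{d_3}$ with $d_1,d_2,d_3$ finite. Party $i\in\{1,2,3\}$ has two measurements, labelled $x_i\in\{0,1\}$, each with outcomes $a_i\in\{+1,-1\}$ and described by positive semidefinite operators $\Pi^{(i)}_{+1|x_i},\Pi^{(i)}_{-1|x_i}$ on $\mathbb{C}^{d_i}$ that add up to the identity; the measurement is projective if both operators are orthogonal projections. Put $$P(a_1,a_2,a_3|x_1,x_2,x_3)=\operatorname{Tr}\bigl[\rho\,(\Pi^{(1)}_{a_1|x_1}\otimes\Pi^{(2)}_{a_2|x_2}\otimes\Pi^{(3)}_{a_3|x_3})\bigr].$$ The tripartite Hardy probability is $p^H_3=P(+1,+1,+1|0,0,0)$, and the zero constraints are $$P(+1,+1,+1|1,0,0)=P(+1,+1,+1|0,1,0)=P(+1,+1,+1|0,0,1)=P(-1,-1,-1|1,1,1)=0.$$ **Theorem.** The maximum of $p^H_3$ under the zero constraints over all three-qubit states ($d_1=d_2=d_3=2$) and all projective measurements is attained, and it equals the maximum of $p^H_3$ under the zero constraints over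 all tripartite states of any finite local dimensions and all (not necessarily projective) measurements with outcomes $\pm1$. Both maxima are equal to $1/8$. The maximum over pure three-qubit states and projective measurements is also $1/8$, and so is the maximum over all states on $\mathbb{C}^{d_1}\otimes\mathbb{C}^{d_2}\otimes\mathbb{C}^{d_3}$ and all measurements with outcomes $\pm1$, for any fixed $d_1,d_2,d_3\ge 2$. -/

import Mathlib

open scoped Kronecker ComplexOrder

namespace TripartiteHardy

/-- A density operator: positive semidefinite with trace one. -/
def IsDensity {ι : Type*} [Fintype ι] (ρ : Matrix ι ι ℂ) : Prop :=
  ρ.PosSemidef ∧ ρ.trace = 1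

/-- A pure state `|ψ⟩⟨ψ|`; the vector `ψ` has norm one as soon as the trace is one. -/
def IsPure {ι : Type*} (ρ : Matrix ι ι ℂ) : Prop :=
  ∃ ψ : ι → ℂ, ρ = Matrix.vecMulVec ψ (star ψ)

/-- A general (POVM) measurement on `ℂ^d` with the two outcomes `+1` and `-1`,
the two elements of `ℤˣ`. -/
def IsPOVM {d : ℕ} (E : ℤˣ → Matrix (Fin d) (Fin d) ℂ) : Prop :=
  (∀ a, (E a).PosSemidef) ∧ E 1 + E (-1) = 1

/-- A projective measurement with outcomes `+1` and `-1`. -/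
def IsProjective {d : ℕ} (E : ℤˣ → Matrix (Fin d) (Fin d) ℂ) : Prop :=
  (∀ a, (E a).IsHermitian ∧ E a * E a = E a) ∧ E 1 + E (-1) = 1

/-- A state of three parties with local dimensions `d₁, d₂, d₃`, and, for each party, two
measurements (settings `0` and `1`), each a general measurement with outcomes `+1` and `-1`. -/
structure Realization (d₁ d₂ d₃ : ℕ) where
  ρ : Matrix (Fin d₁ × Fin d₂ × Fin d₃) (Fin d₁ × Fin d₂ × Fin d₃) ℂ
  A₁ : Fin 2 → ℤˣ → Matrix (Fin d₁) (Fin d₁) ℂ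
  A₂ : Fin 2 → ℤˣ → Matrix (Fin d₂) (Fin d₂) ℂ
  A₃ : Fin 2 → ℤˣ → Matrix (Fin d₃) (Fin d₃) ℂ
  density : IsDensity ρ
  povm₁ : ∀ x, IsPOVM (A₁ x)
  povm₂ : ∀ x, IsPOVM (A₂ x)
  povm₃ : ∀ x, IsPOVM (A₃ x)

namespace Realization

variable {d₁ d₂ d₃ : ℕ}

/-- The joint probability `P(a₁, a₂, a₃ | x₁, x₂, x₃)`, by the Born rule. The trace is a
(nonnegative) real number, so taking the real part only changes its type. -/
noncomputable def prob (R : Realization d₁ d₂ d₃) (a₁ a₂ a₃ : ℤˣ) (x₁ x₂ x₃ : Fin 2) : ℝ :=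
  (R.ρ * (R.A₁ x₁ a₁ ⊗ₖ (R.A₂ x₂ a₂ ⊗ₖ R.A₃ x₃ a₃))).trace.re

/-- All measurements of all parties are projective. -/
def Projective (R : Realization d₁ d₂ d₃) : Prop :=
  (∀ x, IsProjective (R.A₁ x)) ∧ (∀ x, IsProjective (R.A₂ x)) ∧ (∀ x, IsProjective (R.A₃ x))

/-- The four zero constraints of the tripartite Hardy argument. -/
def ZeroConstraints (R : Realization d₁ d₂ d₃) : Prop :=
  R.prob 1 1 1 1 0 0 = 0 ∧
  R.prob 1 1 1 0 1 0 = 0 ∧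
  R.prob 1 1 1 0 0 1 = 0 ∧
  R.prob (-1) (-1) (-1) 1 1 1 = 0

/-- The tripartite Hardy probability `P(+1, +1, +1 | 0, 0, 0)`. -/
noncomputable def hardyProb (R : Realization d₁ d₂ d₃) : ℝ :=
  R.prob 1 1 1 0 0 0

end Realization

/-- The Hardy probabilities attained under the zero constraints by arbitrary (mixed) states
on `ℂ^d₁ ⊗ ℂ^d₂ ⊗ ℂ^d₃` and arbitrary binary measurements. -/
def hardyValues (d₁ d₂ d₃ : ℕ) : Set ℝ :=
  {p | ∃ R : Realization d₁ d₂ d₃, R.ZeroConstraints ∧ R.hardyProb = p}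

/-- The Hardy probabilities attained under the zero constraints by tripartite states of any
finite local dimensions and arbitrary binary measurements. -/
def finiteDimHardyValues : Set ℝ :=
  {p | ∃ d₁ d₂ d₃ : ℕ, p ∈ hardyValues d₁ d₂ d₃}

/-- The Hardy probabilities attained under the zero constraints by arbitrary (mixed) states
of three qubits and projective measurements. -/
def qubitHardyValues : Set ℝ :=
  {p | ∃ R : Realization 2 2 2, R.Projective ∧ R.ZeroConstraints ∧ R.hardyProb = p}

/-- As `qubitHardyValues`, with pure states only. -/
def pureQubitHardyValues : Set ℝ :=
  {p | ∃ R : Realization 2 2 2,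
    IsPure R.ρ ∧ R.Projective ∧ R.ZeroConstraints ∧ R.hardyProb = p}

end TripartiteHardy

namespace TripartiteHardy

open scoped MatrixOrder

open Matrix

/-! Write `E`, `F` for a party's `+1` effects in settings 0 and 1. Replacing effects by their
support projections keeps the zero constraints and cannot lower the Hardy probability
(`expect_le_of_effects`). Two projections commute with `(E - F)²`, so its spectral projections cut
each party into blocks on which `E F E = z E` (`exists_isAnglePair_decomposition`). It suffices to
show `8 tr ρ(E⊗E⊗E) ≤ tr ρ(Q⊗Q⊗Q)` for each triple of blocks `Q`; the right sides sum to 1.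

In one triple, the constraints say that `ρ` kills `F⊗E⊗E`, its permutations and `(Q-F)⊗(Q-F)⊗(Q-F)`.
Subtracting such operators, applied to `E⊗E⊗E`, from `E⊗E⊗E` gives `v` (`certificate`) with `ρ v = ρ
(E⊗E⊗E)` and `vᴴ v = g • E⊗E⊗E`; suitable coefficients make `g ≤ 1/8` (`exists_coeff_le`).
Positivity of `(Q⊗Q⊗Q - 8v)ᴴ(Q⊗Q⊗Q - 8v)` then gives the bound.

Equality in the scalar bound at `z = 1/2` suggests the optimum: for `|+⟩` and `|0⟩`, the residual of
`|+++⟩` modulo the constraint vectors, normalized, is `optimalVector`. Isometric embedding carries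
it to larger dimensions. -/

/-- The triple Kronecker product `A ⊗ (B ⊗ C)`. -/
abbrev kron₃ {l m n l' m' n' : Type*} (A : Matrix l l' ℂ) (B : Matrix m m' ℂ)
    (C : Matrix n n' ℂ) : Matrix (l × m × n) (l' × m' × n') ℂ :=
  A ⊗ₖ (B ⊗ₖ C)

/-- The real part of the expectation of `X` in the state `ρ`. -/
noncomputable def expect {n : Type*} [Fintype n] (ρ : Matrix n n ℂ) :
    Matrix n n ℂ →ₗ[ℝ] ℝ where
  toFun X := (ρ * X).trace.re
  map_add' X Y := by simp [mul_add]
  map_smul' r X := by simp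

/-! ### The scalar inequality behind 1/8 -/

section Scalar

/-- Both sides depend only on `abc` and `ab + bc + ca`, and the gap increases with the latter. With
`abc = q³`, AM-GM gives `ab + bc + ca ≥ 3q²`, leaving a polynomial in `q`; cube roots keep
everything polynomial. -/
theorem eight_mul_prod_mul_le {a b c : ℝ} (ha : 0 ≤ a) (hb : 0 ≤ b) (hc : 0 ≤ c)
    (ha' : a ≤ 1) (hb' : b ≤ 1) (hc' : c ≤ 1) :
    8 * (a * b * c) * (1 - (a * b + b * c + c * a - 2 * (a * b * c)))
      ≤ a * b + b * c + c * a - 2 * (a * b * c) := by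
  have root : ∀ x : ℝ, 0 ≤ x → x ≤ 1 → ∃ r : ℝ, 0 ≤ r ∧ r ≤ 1 ∧ r ^ 3 = x := fun x hx hx1 =>
    ⟨x ^ ((3 : ℕ) : ℝ)⁻¹, by positivity, Real.rpow_le_one hx hx1 (by positivity),
      Real.rpow_inv_natCast_pow hx (by norm_num)⟩
  obtain ⟨x, hx, hx1, rfl⟩ := root a ha ha'
  obtain ⟨y, hy, hy1, rfl⟩ := root b hb hb'
  obtain ⟨z, hz, hz1, rfl⟩ := root c hc hc'
  have amgm : ∀ u v w : ℝ, 0 ≤ u → 0 ≤ v → 0 ≤ w → 3 * (u * v * w) ≤ u ^ 3 + v ^ 3 + w ^ 3 := by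
    intro u v w hu hv hw
    nlinarith [mul_nonneg (add_nonneg (add_nonneg hu hv) hw)
      (add_nonneg (add_nonneg (sq_nonneg (u - v)) (sq_nonneg (v - w))) (sq_nonneg (w - u)))]
  have h := amgm (x * y) (y * z) (z * x) (by positivity) (by positivity) (by positivity)
  set e := x ^ 3 * y ^ 3 + y ^ 3 * z ^ 3 + z ^ 3 * x ^ 3 with he
  obtain ⟨q, hq⟩ : ∃ q, q = x * y * z := ⟨_, rfl⟩
  have hq0 : 0 ≤ q := hq ▸ by positivity
  have hq1 : q ≤ 1 := hq ▸ mul_le_one₀ (mul_le_one₀ hx1 hy hy1) hz hz1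
  have h3 : x ^ 3 * y ^ 3 * z ^ 3 = q ^ 3 := by rw [hq]; ring
  have h2 : 3 * q ^ 2 ≤ e := by
    rw [he, hq]; linarith
  rw [h3]
  -- This is the gap at `e = 3q²`. The double root `q = 1/2` is the case `a = b = c = 1/2`.
  have key : 0 ≤ q ^ 2 * (1 - 2 * q) ^ 2 * (3 + 2 * q - 4 * q ^ 2) := by
    have : 0 ≤ 3 + 2 * q - 4 * q ^ 2 := by nlinarith
    positivity
  have h4 : 0 ≤ (e - 3 * q ^ 2) * (1 + 8 * q ^ 3) :=
    mul_nonneg (by linarith) (by positivity)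
  nlinarith

theorem exists_coeff_le {z₁ z₂ z₃ : ℝ} (h₁ : 0 ≤ z₁) (h₂ : 0 ≤ z₂) (h₃ : 0 ≤ z₃)
    (h₁' : z₁ ≤ 1) (h₂' : z₂ ≤ 1) (h₃' : z₃ ≤ 1) :
    ∃ β₁ β₂ β₃ : ℝ,
      1 - 2 * (β₁ * z₁ + β₂ * z₂ + β₃ * z₃) + (β₁ ^ 2 * z₁ + β₂ ^ 2 * z₂ + β₃ ^ 2 * z₃)
        + 2 * (β₁ * β₂ * z₁ * z₂ + β₁ * β₃ * z₁ * z₃ + β₂ * β₃ * z₂ * z₃)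
        - (1 - z₁) * (1 - z₂) * (1 - z₃) ≤ 1 / 8 := by
  -- If some `zᵢ = 1`, taking `βᵢ = 1` alone makes the left side 0. Excluding this keeps the
  -- denominator `D` positive.
  rcases eq_or_lt_of_le h₁' with rfl | h₁'
  · exact ⟨1, 0, 0, by norm_num⟩
  rcases eq_or_lt_of_le h₂' with rfl | h₂'
  · exact ⟨0, 1, 0, by norm_num⟩
  rcases eq_or_lt_of_le h₃' with rfl | h₃'
  · exact ⟨0, 0, 1, by norm_num⟩
  obtain ⟨a, rfl⟩ : ∃ a, z₁ = 1 - a := ⟨1 - z₁, by ring⟩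
  obtain ⟨b, rfl⟩ : ∃ b, z₂ = 1 - b := ⟨1 - z₂, by ring⟩
  obtain ⟨c, rfl⟩ : ∃ c, z₃ = 1 - c := ⟨1 - z₃, by ring⟩
  have ha : 0 < a := by linarith
  have hb : 0 < b := by linarith
  have hc : 0 < c := by linarith
  have key := eight_mul_prod_mul_le ha.le hb.le hc.le (by linarith) (by linarith) (by linarith)
  set D := a * b + b * c + c * a - 2 * (a * b * c) with hD
  have hDpos : 0 < D := by
    have : D = a * b * c + (1 - a) * (b * c) + (1 - b) * (c * a) + (1 - c) * (a * b) := by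
      rw [hD]; ring
    rw [this]
    have := mul_nonneg h₁ (mul_pos hb hc).le
    have := mul_nonneg h₂ (mul_pos hc ha).le
    have := mul_nonneg h₃ (mul_pos ha hb).le
    have : 0 < a * b * c := by positivity
    linarith
  -- The minimizer of a convex quadratic: stationarity reads `βᵢ (1 - zᵢ) = 1 - ∑ⱼ βⱼ zⱼ`, so `βᵢ`
  -- is proportional to `1 / (1 - zᵢ)`.
  refine ⟨b * c / D, c * a / D, a * b / D, ?_⟩
  have : 1 - 2 * (b * c / D * (1 - a) + c * a / D * (1 - b) + a * b / D * (1 - c))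
        + ((b * c / D) ^ 2 * (1 - a) + (c * a / D) ^ 2 * (1 - b) + (a * b / D) ^ 2 * (1 - c))
        + 2 * (b * c / D * (c * a / D) * (1 - a) * (1 - b)
          + b * c / D * (a * b / D) * (1 - a) * (1 - c)
          + c * a / D * (a * b / D) * (1 - b) * (1 - c))
        - (1 - (1 - a)) * (1 - (1 - b)) * (1 - (1 - c))
      = a * b * c / D - a * b * c := by
    field_simp
    rw [hD]
    ring
  rw [this, sub_le_iff_le_add, div_le_iff₀ hDpos]
  linarith

end Scalar

/-! ### Expectations and spectral projections -/

section Matrices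

variable {n : Type*} [Fintype n]

theorem expect_apply (ρ X : Matrix n n ℂ) : expect ρ X = (ρ * X).trace.re := rfl

theorem expect_conjTranspose_mul_self_nonneg {ρ : Matrix n n ℂ} (hρ : ρ.PosSemidef)
    (X : Matrix n n ℂ) : 0 ≤ expect ρ (Xᴴ * X) := by
  rw [expect_apply, ← mul_assoc, trace_mul_comm, ← mul_assoc]
  exact (Complex.le_def.mp (hρ.mul_mul_conjTranspose_same X).trace_nonneg).1

theorem expect_nonneg [DecidableEq n] {ρ X : Matrix n n ℂ} (hρ : ρ.PosSemidef)
    (hX : X.PosSemidef) : 0 ≤ expect ρ X := by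
  obtain ⟨B, rfl⟩ := CStarAlgebra.nonneg_iff_eq_star_mul_self.mp hX.nonneg
  exact expect_conjTranspose_mul_self_nonneg hρ B

/-- With `ρ = Bᴴ B`, the trace of `ρ P` is the squared Hilbert–Schmidt norm of `B P`. -/
theorem mul_eq_zero_of_expect_eq_zero [DecidableEq n] {ρ P : Matrix n n ℂ} (hρ : ρ.PosSemidef)
    (hP : P.IsHermitian) (hP' : P * P = P) (h : expect ρ P = 0) : ρ * P = 0 := by
  obtain ⟨B, rfl⟩ := CStarAlgebra.nonneg_iff_eq_star_mul_self.mp hρ.nonneg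
  have h0 : ((B * P)ᴴ * (B * P)).trace = 0 := by
    have hnn := (posSemidef_conjTranspose_mul_self (B * P)).trace_nonneg
    have hre : ((B * P)ᴴ * (B * P)).trace.re = 0 := by
      rw [← h, expect_apply, conjTranspose_mul, hP.eq, mul_assoc, trace_mul_comm, mul_assoc,
        mul_assoc, mul_assoc, hP', star_eq_conjTranspose]
    exact Complex.ext hre (Complex.le_def.mp hnn).2.symm
  rw [trace_conjTranspose_mul_self_eq_zero_iff] at h0
  rw [mul_assoc, h0, mul_zero]

/-- Indicators of points, applied to `S` by functional calculus: the spectrum is finite, so every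
function on it is continuous. Off the spectrum `Q t = 0`, which is why `t` can be arbitrary. -/
theorem exists_spectral_projections [DecidableEq n] {S : Matrix n n ℂ} (hS : S.IsHermitian) :
    ∃ (s : Finset ℝ) (Q : ℝ → Matrix n n ℂ), ∑ t ∈ s, Q t = 1 ∧ ∀ t,
      (Q t).IsHermitian ∧ Q t * Q t = Q t ∧ Q t * S = t • Q t ∧
      ∀ X, Commute S X → Commute (Q t) X := by
  have hfin : (spectrum ℝ S).Finite := Matrix.finite_real_spectrum
  have hS' : IsSelfAdjoint S := hS
  have hc : ∀ f : ℝ → ℝ, ContinuousOn f (spectrum ℝ S) := fun f => hfin.continuousOn f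
  refine ⟨hfin.toFinset, fun t => cfc (fun x => if x = t then (1 : ℝ) else 0) S, ?_, fun t =>
    ⟨cfc_predicate _ S, ?_, ?_, fun X hX => hX.cfc_real _⟩⟩
  · rw [← cfc_sum _ _ _ (fun _ _ => hc _), ← cfc_one ℝ S]
    refine cfc_congr fun x hx => ?_
    have : x ∈ hfin.toFinset := by simpa using hx
    simp [this]
  · rw [← cfc_mul _ _ _ (hc _) (hc _)]
    refine cfc_congr fun x _ => ?_
    simp
  · rw [← cfc_smul _ _ _ (hc _)]
    nth_rewrite 2 [← cfc_id ℝ S]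
    rw [← cfc_mul _ _ _ (hc _) (hc _)]
    refine cfc_congr fun x _ => ?_
    by_cases h : x = t <;> simp [h]

/-- Both comparisons matter: `ε • P ≤ E` passes zero probabilities from `E` to `P`, and `E ≤ P` does
so for the complements. -/
theorem exists_support_projection [DecidableEq n] {E : Matrix n n ℂ} (h0 : 0 ≤ E)
    (h1 : E ≤ 1) : ∃ (P : Matrix n n ℂ) (ε : ℝ), P.IsHermitian ∧ P * P = P ∧ 0 < ε ∧
      ε • P ≤ E ∧ E ≤ P := by
  have hE : IsSelfAdjoint E := .of_nonneg h0
  have hfin : (spectrum ℝ E).Finite := Matrix.finite_real_spectrum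
  have hc : ∀ f : ℝ → ℝ, ContinuousOn f (spectrum ℝ E) := fun f => hfin.continuousOn f
  have hs0 : ∀ x ∈ spectrum ℝ E, 0 ≤ x := fun x hx => spectrum_nonneg_of_nonneg h0 hx
  have hs1 : ∀ x ∈ spectrum ℝ E, x ≤ 1 := by
    have : E ≤ algebraMap ℝ _ 1 := by simpa using h1
    exact (le_algebraMap_iff_spectrum_le).mp this
  obtain ⟨ε, hε, hmin⟩ : ∃ ε : ℝ, 0 < ε ∧ ∀ x ∈ spectrum ℝ E, 0 < x → ε ≤ x := by
    -- The 1 covers the case of no positive eigenvalue.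
    have hne : (insert 1 (hfin.toFinset.filter (0 < ·))).Nonempty := ⟨1, by simp⟩
    refine ⟨(insert 1 (hfin.toFinset.filter (0 < ·))).min' hne, ?_, fun x hx hx0 =>
      Finset.min'_le _ _ (by simp [hx, hx0])⟩
    rw [Finset.lt_min'_iff]
    intro y hy
    simp only [Finset.mem_insert, Finset.mem_filter] at hy
    rcases hy with rfl | hy
    · exact one_pos
    · exact hy.2
  refine ⟨cfc (fun x => if 0 < x then (1 : ℝ) else 0) E, ε, cfc_predicate _ E, ?_, hε, ?_, ?_⟩
  · rw [← cfc_mul _ _ _ (hc _) (hc _)]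
    refine cfc_congr fun x _ => ?_
    simp
  · rw [← cfc_smul _ _ _ (hc _)]
    nth_rewrite 2 [← cfc_id ℝ E]
    refine (cfc_le_iff _ _ _ (hc _) (hc _)).mpr fun x hx => ?_
    by_cases h : 0 < x
    · simpa [h] using hmin x hx h
    · simpa [h] using hs0 x hx
  · nth_rewrite 1 [← cfc_id ℝ E]
    refine (cfc_le_iff _ _ _ (hc _) (hc _)).mpr fun x hx => ?_
    by_cases h : 0 < x
    · simpa [h] using hs1 x hx
    · simp only [h, if_false]; exact not_lt.mp h

end Matrices

/-! ### Triple Kronecker products -/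

section Kron

variable {l m n : Type*}

theorem kron₃_mul [Fintype l] [Fintype m] [Fintype n] (A A' : Matrix l l ℂ) (B B' : Matrix m m ℂ)
    (C C' : Matrix n n ℂ) :
    kron₃ A B C * kron₃ A' B' C' = kron₃ (A * A') (B * B') (C * C') := by
  simp [kron₃, mul_kronecker_mul]

theorem kron₃_isHermitian {A : Matrix l l ℂ} {B : Matrix m m ℂ} {C : Matrix n n ℂ}
    (hA : A.IsHermitian) (hB : B.IsHermitian) (hC : C.IsHermitian) :
    (kron₃ A B C).IsHermitian := by
  simp [IsHermitian, kron₃, conjTranspose_kronecker, hA.eq, hB.eq, hC.eq]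

theorem kron₃_le_kron₃ [Fintype l] [Fintype m] [Fintype n] [DecidableEq l] [DecidableEq m]
    [DecidableEq n] {A A' : Matrix l l ℂ} {B B' : Matrix m m ℂ} {C C' : Matrix n n ℂ}
    (hA : A ≤ A') (hB : B ≤ B') (hC : C ≤ C') (hA' : 0 ≤ A') (hB0 : 0 ≤ B) (hB' : 0 ≤ B')
    (hC0 : 0 ≤ C) : kron₃ A B C ≤ kron₃ A' B' C' := by
  -- Telescoping: one factor is changed at a time.
  have h := ((le_iff.mp hA).kronecker (hB0.posSemidef.kronecker hC0.posSemidef)).add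
    ((hA'.posSemidef.kronecker ((le_iff.mp hB).kronecker hC0.posSemidef)).add
      (hA'.posSemidef.kronecker (hB'.posSemidef.kronecker (le_iff.mp hC))))
  rw [le_iff]
  convert h using 1
  ext ⟨i, j, k⟩ ⟨i', j', k'⟩
  simp [kron₃, kroneckerMap_apply]
  ring

end Kron

theorem posSemidef_of_projection {n : Type*} [Fintype n] {A : Matrix n n ℂ} (hA : A.IsHermitian)
    (hA' : A * A = A) : A.PosSemidef := by
  have := posSemidef_conjTranspose_mul_self A
  rwa [hA.eq, hA'] at this

/-! ### Pairs of projections at a single angle -/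

/-- Orthogonal projections `E, F ≤ Q` whose relative position is one angle `θ` with
`cos² θ = z`. -/
structure IsAnglePair {n : Type*} [Fintype n] (Q E F : Matrix n n ℂ) (z : ℝ) : Prop where
  hermQ : Q.IsHermitian
  hermE : E.IsHermitian
  hermF : F.IsHermitian
  idemQ : Q * Q = Q
  idemE : E * E = E
  idemF : F * F = F
  mulE : Q * E = E
  mulF : Q * F = F
  angle : E * F * E = z • E

namespace IsAnglePair

variable {n : Type*} [Fintype n] {Q E F : Matrix n n ℂ} {z : ℝ}

theorem mulF' (h : IsAnglePair Q E F z) : F * Q = F := by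
  simpa [h.hermF.eq, h.hermQ.eq] using congrArg conjTranspose h.mulF

theorem idem_compl (h : IsAnglePair Q E F z) : (Q - F) * (Q - F) = Q - F := by
  simp [mul_sub, sub_mul, h.idemQ, h.idemF, h.mulF, h.mulF']

/-- The products of the words `E`, `E F`, `E (Q - F)` with the words `E`, `F E`, `(Q - F) E`. -/
theorem words (h : IsAnglePair Q E F z) :
    E * (F * E) = z • E ∧ E * F * (F * E) = z • E ∧
    E * ((Q - F) * E) = (1 - z) • E ∧ E * (Q - F) * E = (1 - z) • E ∧
    E * (Q - F) * ((Q - F) * E) = (1 - z) • E ∧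
    E * F * ((Q - F) * E) = 0 ∧ E * (Q - F) * (F * E) = 0 := by
  have h1 : E * ((Q - F) * E) = (1 - z) • E := by
    rw [sub_mul, mul_sub, h.mulE, h.idemE, ← mul_assoc, h.angle, sub_smul, one_smul]
  refine ⟨by rw [← mul_assoc, h.angle], ?_, h1, by rw [mul_assoc, h1], ?_, ?_, ?_⟩
  · rw [mul_assoc, ← mul_assoc F, h.idemF, ← mul_assoc, h.angle]
  · rw [mul_assoc, ← mul_assoc (Q - F), h.idem_compl, h1]
  · rw [mul_assoc, ← mul_assoc F, mul_sub, h.idemF, h.mulF', sub_self, zero_mul, mul_zero]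
  · rw [mul_assoc, ← mul_assoc (Q - F), sub_mul, h.idemF, h.mulF, sub_self, zero_mul, mul_zero]

/-- This and the next lemma yield `0 ≤ z ≤ 1` when `E ≠ 0`; for `E = 0` the number `z` is
unconstrained. -/
theorem posSemidef_smul (h : IsAnglePair Q E F z) : (z • E).PosSemidef := by
  have := posSemidef_conjTranspose_mul_self (F * E)
  rwa [conjTranspose_mul, h.hermE.eq, h.hermF.eq, h.words.2.1] at this

theorem posSemidef_one_sub_smul (h : IsAnglePair Q E F z) : ((1 - z) • E).PosSemidef := by
  have := posSemidef_conjTranspose_mul_self ((Q - F) * E)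
  rwa [conjTranspose_mul, h.hermE.eq, (h.hermQ.sub h.hermF).eq, h.words.2.2.2.2.1] at this

end IsAnglePair

/-! ### The dual certificate on one triple of blocks -/

section AnglePairs

variable {l m n : Type*} [Fintype l] [Fintype m] [Fintype n]
  [DecidableEq l] [DecidableEq m] [DecidableEq n]
  {ρ : Matrix (l × m × n) (l × m × n) ℂ}
  {Q₁ E₁ F₁ : Matrix l l ℂ} {Q₂ E₂ F₂ : Matrix m m ℂ} {Q₃ E₃ F₃ : Matrix n n ℂ} {z₁ z₂ z₃ : ℝ}

/-- The vector operator of the dual certificate. -/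
noncomputable def certificate (Q₁ E₁ F₁ : Matrix l l ℂ) (Q₂ E₂ F₂ : Matrix m m ℂ)
    (Q₃ E₃ F₃ : Matrix n n ℂ) (β₁ β₂ β₃ : ℝ) : Matrix (l × m × n) (l × m × n) ℂ :=
  kron₃ E₁ E₂ E₃ - β₁ • kron₃ (F₁ * E₁) E₂ E₃ - β₂ • kron₃ E₁ (F₂ * E₂) E₃
    - β₃ • kron₃ E₁ E₂ (F₃ * E₃)
    - kron₃ ((Q₁ - F₁) * E₁) ((Q₂ - F₂) * E₂) ((Q₃ - F₃) * E₃)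

omit [DecidableEq l] [DecidableEq m] [DecidableEq n] in
theorem conjTranspose_certificate (h₁ : IsAnglePair Q₁ E₁ F₁ z₁) (h₂ : IsAnglePair Q₂ E₂ F₂ z₂)
    (h₃ : IsAnglePair Q₃ E₃ F₃ z₃) (β₁ β₂ β₃ : ℝ) :
    (certificate Q₁ E₁ F₁ Q₂ E₂ F₂ Q₃ E₃ F₃ β₁ β₂ β₃)ᴴ =
      kron₃ E₁ E₂ E₃ - β₁ • kron₃ (E₁ * F₁) E₂ E₃ - β₂ • kron₃ E₁ (E₂ * F₂) E₃
        - β₃ • kron₃ E₁ E₂ (E₃ * F₃)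
        - kron₃ (E₁ * (Q₁ - F₁)) (E₂ * (Q₂ - F₂)) (E₃ * (Q₃ - F₃)) := by
  simp [certificate, kron₃, conjTranspose_kronecker, conjTranspose_smul, h₁.hermE.eq, h₁.hermF.eq,
    h₁.hermQ.eq, h₂.hermE.eq, h₂.hermF.eq, h₂.hermQ.eq, h₃.hermE.eq, h₃.hermF.eq, h₃.hermQ.eq]

omit [DecidableEq l] [DecidableEq m] [DecidableEq n] in
theorem conjTranspose_certificate_mul_self (h₁ : IsAnglePair Q₁ E₁ F₁ z₁)
    (h₂ : IsAnglePair Q₂ E₂ F₂ z₂) (h₃ : IsAnglePair Q₃ E₃ F₃ z₃) (β₁ β₂ β₃ : ℝ) :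
    (certificate Q₁ E₁ F₁ Q₂ E₂ F₂ Q₃ E₃ F₃ β₁ β₂ β₃)ᴴ *
        certificate Q₁ E₁ F₁ Q₂ E₂ F₂ Q₃ E₃ F₃ β₁ β₂ β₃ =
      (1 - 2 * (β₁ * z₁ + β₂ * z₂ + β₃ * z₃) + (β₁ ^ 2 * z₁ + β₂ ^ 2 * z₂ + β₃ ^ 2 * z₃)
        + 2 * (β₁ * β₂ * z₁ * z₂ + β₁ * β₃ * z₁ * z₃ + β₂ * β₃ * z₂ * z₃)
        - (1 - z₁) * (1 - z₂) * (1 - z₃)) • kron₃ E₁ E₂ E₃ := by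
  rw [conjTranspose_certificate h₁ h₂ h₃, certificate]
  obtain ⟨a1, a2, a3, a4, a5, a6, a7⟩ := h₁.words
  obtain ⟨b1, b2, b3, b4, b5, b6, b7⟩ := h₂.words
  obtain ⟨c1, c2, c3, c4, c5, c6, c7⟩ := h₃.words
  have z₁' : ∀ (B : Matrix m m ℂ) (C : Matrix n n ℂ), kron₃ (0 : Matrix l l ℂ) B C = 0 := by
    simp [kron₃]
  have z₂' : ∀ (B : Matrix l l ℂ) (C : Matrix n n ℂ), kron₃ B (0 : Matrix m m ℂ) C = 0 := by
    simp [kron₃]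
  have z₃' : ∀ (B : Matrix l l ℂ) (C : Matrix m m ℂ), kron₃ B C (0 : Matrix n n ℂ) = 0 := by
    simp [kron₃]
  have s₁ : ∀ (r : ℝ) (A : Matrix l l ℂ) (B : Matrix m m ℂ) (C : Matrix n n ℂ),
      kron₃ (r • A) B C = r • kron₃ A B C := by simp [kron₃, smul_kronecker]
  have s₂ : ∀ (r : ℝ) (A : Matrix l l ℂ) (B : Matrix m m ℂ) (C : Matrix n n ℂ),
      kron₃ A (r • B) C = r • kron₃ A B C := by simp [kron₃, smul_kronecker, kronecker_smul]
  have s₃ : ∀ (r : ℝ) (A : Matrix l l ℂ) (B : Matrix m m ℂ) (C : Matrix n n ℂ),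
      kron₃ A B (r • C) = r • kron₃ A B C := by simp [kron₃, kronecker_smul]
  -- Only the outer differences are expanded, so that `Q - F` remains one letter of the words. The
  -- last term of the certificate is orthogonal to the `β` terms since `E F (Q - F) E = 0`; hence
  -- its coefficient 1 is optimal.
  simp only [mul_sub _ (_ - _) (_ • _),
    mul_sub _ (_ - _) (kron₃ _ _ _), mul_sub _ (kron₃ _ _ _) (_ • _), sub_mul _ (_ • _),
    sub_mul _ (kron₃ _ _ _), smul_mul_assoc, mul_smul_comm, kron₃_mul, h₁.idemE,
    h₂.idemE, h₃.idemE, h₁.angle, h₂.angle, h₃.angle, a1, a2, a3, a4, a5, a6, a7,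
    b1, b2, b3, b4, b5, b6, b7, c1, c2, c3, c4, c5, c6, c7, z₁', z₂', z₃', s₁, s₂, s₃]
  module

/-- The bound on the Hardy probability when every party's two projections have one angle. -/
theorem expect_le_of_isAnglePair (hρ : ρ.PosSemidef)
    (h₁ : IsAnglePair Q₁ E₁ F₁ z₁) (h₂ : IsAnglePair Q₂ E₂ F₂ z₂) (h₃ : IsAnglePair Q₃ E₃ F₃ z₃)
    (k₁ : ρ * kron₃ F₁ E₂ E₃ = 0) (k₂ : ρ * kron₃ E₁ F₂ E₃ = 0) (k₃ : ρ * kron₃ E₁ E₂ F₃ = 0)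
    (k₀ : ρ * kron₃ (Q₁ - F₁) (Q₂ - F₂) (Q₃ - F₃) = 0) :
    8 * expect ρ (kron₃ E₁ E₂ E₃) ≤ expect ρ (kron₃ Q₁ Q₂ Q₃) := by
  have hQ0 : 0 ≤ expect ρ (kron₃ Q₁ Q₂ Q₃) := expect_nonneg hρ
    ((posSemidef_of_projection h₁.hermQ h₁.idemQ).kronecker
      ((posSemidef_of_projection h₂.hermQ h₂.idemQ).kronecker
        (posSemidef_of_projection h₃.hermQ h₃.idemQ)))
  have p₁ := posSemidef_of_projection h₁.hermE h₁.idemE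
  have p₂ := posSemidef_of_projection h₂.hermE h₂.idemE
  have p₃ := posSemidef_of_projection h₃.hermE h₃.idemE
  have hE0 : 0 ≤ expect ρ (kron₃ E₁ E₂ E₃) := expect_nonneg hρ (p₁.kronecker (p₂.kronecker p₃))
  rcases hE0.eq_or_lt with hE | hE
  · rw [← hE]; linarith
  -- A positive expectation rules out `Eᵢ = 0`, so the semidefinite multiples of `Eᵢ` confine `zᵢ`
  -- to `[0, 1]`.
  have bound : ∀ r : ℝ, (r • kron₃ E₁ E₂ E₃).PosSemidef → 0 ≤ r := fun r hr => by
    have := expect_nonneg hρ hr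
    rw [map_smul, smul_eq_mul] at this
    exact nonneg_of_mul_nonneg_left this hE
  have b₁ : ∀ r : ℝ, (r • E₁).PosSemidef → 0 ≤ r := fun r hr => bound r (by
    have := hr.kronecker (p₂.kronecker p₃)
    rwa [smul_kronecker] at this)
  have b₂ : ∀ r : ℝ, (r • E₂).PosSemidef → 0 ≤ r := fun r hr => bound r (by
    have := p₁.kronecker (hr.kronecker p₃)
    rwa [smul_kronecker, kronecker_smul] at this)
  have b₃ : ∀ r : ℝ, (r • E₃).PosSemidef → 0 ≤ r := fun r hr => bound r (by
    have := p₁.kronecker (p₂.kronecker hr)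
    rwa [kronecker_smul, kronecker_smul] at this)
  obtain ⟨β₁, β₂, β₃, hβ⟩ := exists_coeff_le (b₁ _ h₁.posSemidef_smul) (b₂ _ h₂.posSemidef_smul)
    (b₃ _ h₃.posSemidef_smul) (sub_nonneg.mp (b₁ _ h₁.posSemidef_one_sub_smul)) (sub_nonneg.mp (b₂ _ h₂.posSemidef_one_sub_smul))
    (sub_nonneg.mp (b₃ _ h₃.posSemidef_one_sub_smul))
  set v := certificate Q₁ E₁ F₁ Q₂ E₂ F₂ Q₃ E₃ F₃ β₁ β₂ β₃ with hv
  have hvv := conjTranspose_certificate_mul_self h₁ h₂ h₃ β₁ β₂ β₃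
  rw [← hv] at hvv
  set g := 1 - 2 * (β₁ * z₁ + β₂ * z₂ + β₃ * z₃) + (β₁ ^ 2 * z₁ + β₂ ^ 2 * z₂ + β₃ ^ 2 * z₃)
        + 2 * (β₁ * β₂ * z₁ * z₂ + β₁ * β₃ * z₁ * z₃ + β₂ * β₃ * z₂ * z₃)
        - (1 - z₁) * (1 - z₂) * (1 - z₃)
  have hQv : kron₃ Q₁ Q₂ Q₃ * v = v := by
    have e₁ : Q₁ * ((Q₁ - F₁) * E₁) = (Q₁ - F₁) * E₁ := by
      rw [← mul_assoc, mul_sub, h₁.idemQ, h₁.mulF]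
    have e₂ : Q₂ * ((Q₂ - F₂) * E₂) = (Q₂ - F₂) * E₂ := by
      rw [← mul_assoc, mul_sub, h₂.idemQ, h₂.mulF]
    have e₃ : Q₃ * ((Q₃ - F₃) * E₃) = (Q₃ - F₃) * E₃ := by
      rw [← mul_assoc, mul_sub, h₃.idemQ, h₃.mulF]
    have f₁ : Q₁ * (F₁ * E₁) = F₁ * E₁ := by rw [← mul_assoc, h₁.mulF]
    have f₂ : Q₂ * (F₂ * E₂) = F₂ * E₂ := by rw [← mul_assoc, h₂.mulF]
    have f₃ : Q₃ * (F₃ * E₃) = F₃ * E₃ := by rw [← mul_assoc, h₃.mulF]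
    rw [hv, certificate, mul_sub, mul_sub, mul_sub, mul_sub]
    simp only [mul_smul_comm, kron₃_mul, e₁, e₂, e₃, f₁, f₂, f₃, h₁.mulE, h₂.mulE, h₃.mulE]
  have hQQ : (kron₃ Q₁ Q₂ Q₃)ᴴ = kron₃ Q₁ Q₂ Q₃ :=
    kron₃_isHermitian h₁.hermQ h₂.hermQ h₃.hermQ
  have hvQ : vᴴ * kron₃ Q₁ Q₂ Q₃ = vᴴ := by
    rw [← hQQ, ← conjTranspose_mul, hQv]
  have hQQ' : kron₃ Q₁ Q₂ Q₃ * kron₃ Q₁ Q₂ Q₃ = kron₃ Q₁ Q₂ Q₃ := by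
    rw [kron₃_mul, h₁.idemQ, h₂.idemQ, h₃.idemQ]
  have hρv : ρ * v = ρ * kron₃ E₁ E₂ E₃ := by
    have c₁ : kron₃ (F₁ * E₁) E₂ E₃ = kron₃ F₁ E₂ E₃ * kron₃ E₁ E₂ E₃ := by
      rw [kron₃_mul, h₂.idemE, h₃.idemE]
    have c₂ : kron₃ E₁ (F₂ * E₂) E₃ = kron₃ E₁ F₂ E₃ * kron₃ E₁ E₂ E₃ := by
      rw [kron₃_mul, h₁.idemE, h₃.idemE]
    have c₃ : kron₃ E₁ E₂ (F₃ * E₃) = kron₃ E₁ E₂ F₃ * kron₃ E₁ E₂ E₃ := by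
      rw [kron₃_mul, h₁.idemE, h₂.idemE]
    have c₀ : kron₃ ((Q₁ - F₁) * E₁) ((Q₂ - F₂) * E₂) ((Q₃ - F₃) * E₃)
        = kron₃ (Q₁ - F₁) (Q₂ - F₂) (Q₃ - F₃) * kron₃ E₁ E₂ E₃ := by rw [kron₃_mul]
    rw [hv, certificate, c₁, c₂, c₃, c₀, mul_sub, mul_sub, mul_sub, mul_sub, mul_smul_comm,
      mul_smul_comm, mul_smul_comm, ← mul_assoc ρ (kron₃ F₁ _ _), ← mul_assoc ρ (kron₃ _ F₂ _),
      ← mul_assoc ρ (kron₃ _ _ F₃), ← mul_assoc ρ (kron₃ (_ - _) _ _), k₁, k₂, k₃, k₀]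
    simp
  have hev : expect ρ v = expect ρ (kron₃ E₁ E₂ E₃) := by rw [expect_apply, hρv, expect_apply]
  have hev' : expect ρ vᴴ = expect ρ v := by
    rw [expect_apply, expect_apply, trace_mul_comm, ← hρ.isHermitian.eq, ← conjTranspose_mul,
      trace_conjTranspose, hρ.isHermitian.eq, Complex.star_def, Complex.conj_re]
  -- With `p`, `q` the expectations of `E⊗E⊗E`, `Q⊗Q⊗Q`, this says `0 ≤ q - 16p + 64gp`, and `g ≤
  -- 1/8` leaves `q - 8p`.
  have hpos := expect_conjTranspose_mul_self_nonneg hρ (kron₃ Q₁ Q₂ Q₃ - (8 : ℝ) • v)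
  have hexp : (kron₃ Q₁ Q₂ Q₃ - (8 : ℝ) • v)ᴴ * (kron₃ Q₁ Q₂ Q₃ - (8 : ℝ) • v)
      = kron₃ Q₁ Q₂ Q₃ - (8 : ℝ) • v - (8 : ℝ) • vᴴ + (64 * g) • kron₃ E₁ E₂ E₃ := by
    rw [conjTranspose_sub, conjTranspose_smul, hQQ, star_trivial, sub_mul, mul_sub, mul_sub,
      smul_mul_assoc, smul_mul_assoc, mul_smul_comm, mul_smul_comm, hQQ', hQv, hvQ, hvv]
    module
  rw [hexp, map_add, map_sub, map_sub, map_smul, map_smul, map_smul, hev', hev, smul_eq_mul,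
    smul_eq_mul] at hpos
  nlinarith

end AnglePairs

/-! ### Jordan's decomposition of two projections -/

/-- Two projections decompose along the spectrum of the square of their difference, which
commutes with both, into pairs with a single angle. -/
theorem exists_isAnglePair_decomposition {n : Type*} [Fintype n] [DecidableEq n]
    {E F : Matrix n n ℂ} (hE : E.IsHermitian) (hF : F.IsHermitian) (hE' : E * E = E)
    (hF' : F * F = F) : ∃ (s : Finset ℝ) (Q : ℝ → Matrix n n ℂ), ∑ t ∈ s, Q t = 1 ∧
      ∀ t, Commute (Q t) E ∧ Commute (Q t) F ∧
        IsAnglePair (Q t) (Q t * E) (Q t * F) (1 - t) := by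
  have hES : E * ((E - F) * (E - F)) = E - E * F * E := by
    simp only [mul_sub, sub_mul, hE', hF', ← mul_assoc]
    simp only [mul_assoc]
    abel
  have hSE : (E - F) * (E - F) * E = E - E * F * E := by
    simp only [mul_sub, sub_mul, hE', hF', mul_assoc]
    abel
  have hFS : F * ((E - F) * (E - F)) = F - F * E * F := by
    simp only [mul_sub, sub_mul, hE', hF', ← mul_assoc]
    simp only [mul_assoc]
    abel
  have hSF : (E - F) * (E - F) * F = F - F * E * F := by
    simp only [mul_sub, sub_mul, hE', hF', mul_assoc]
    abel
  have hS : ((E - F) * (E - F)).IsHermitian := by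
    rw [IsHermitian, conjTranspose_mul, (hE.sub hF).eq]
  obtain ⟨s, Q, hsum, hQ⟩ := exists_spectral_projections hS
  refine ⟨s, Q, hsum, fun t => ?_⟩
  obtain ⟨hherm, hidem, heig, hcomm⟩ := hQ t
  have cE : Commute (Q t) E := hcomm E (hSE.trans hES.symm)
  have cF : Commute (Q t) F := hcomm F (hSF.trans hFS.symm)
  have cut : ∀ A B, Commute (Q t) A → Q t * A * (Q t * B) = Q t * (A * B) := fun A B hA => by
    rw [hA.eq, mul_assoc, ← mul_assoc (Q t), hidem, ← mul_assoc, ← hA.eq, mul_assoc]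
  refine ⟨cE, cF, hherm, ?_, ?_, hidem, ?_, ?_, ?_, ?_, ?_⟩
  · rw [IsHermitian, conjTranspose_mul, hE.eq, hherm.eq, cE.eq]
  · rw [IsHermitian, conjTranspose_mul, hF.eq, hherm.eq, cF.eq]
  · rw [cut _ _ cE, hE']
  · rw [cut _ _ cF, hF']
  · rw [← mul_assoc, hidem]
  · rw [← mul_assoc, hidem]
  · have hEFE : E * F * E = E - (E - F) * (E - F) * E := by rw [hSE]; abel
    rw [cut _ _ cE, cut _ _ (cE.mul_right cF), hEFE, mul_sub, ← mul_assoc (Q t), heig,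
      smul_mul_assoc, sub_smul, one_smul]

/-! ### From blocks to projections to effects -/

section Bound

variable {l m n : Type*} [Fintype l] [Fintype m] [Fintype n]
  [DecidableEq l] [DecidableEq m] [DecidableEq n]
  {ρ : Matrix (l × m × n) (l × m × n) ℂ}

omit [Fintype l] [Fintype m] [Fintype n] [DecidableEq l] [DecidableEq m] [DecidableEq n] in
theorem kron₃_sum (s t u : Finset ℝ) (A : ℝ → Matrix l l ℂ) (B : ℝ → Matrix m m ℂ)
    (C : ℝ → Matrix n n ℂ) :
    kron₃ (∑ i ∈ s, A i) (∑ j ∈ t, B j) (∑ k ∈ u, C k)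
      = ∑ i ∈ s, ∑ j ∈ t, ∑ k ∈ u, kron₃ (A i) (B j) (C k) := by
  ext ⟨a, b, c⟩ ⟨a', b', c'⟩
  simp only [kron₃, kroneckerMap_apply, Matrix.sum_apply]
  rw [Finset.sum_mul_sum t u, Finset.sum_mul]
  simp only [Finset.mul_sum]

/-- The Hardy bound for projections. -/
theorem expect_le_of_projections (hρ : ρ.PosSemidef)
    {E₁ F₁ : Matrix l l ℂ} {E₂ F₂ : Matrix m m ℂ} {E₃ F₃ : Matrix n n ℂ}
    (hE₁ : E₁.IsHermitian) (hE₂ : E₂.IsHermitian) (hE₃ : E₃.IsHermitian)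
    (hF₁ : F₁.IsHermitian) (hF₂ : F₂.IsHermitian) (hF₃ : F₃.IsHermitian)
    (iE₁ : E₁ * E₁ = E₁) (iE₂ : E₂ * E₂ = E₂) (iE₃ : E₃ * E₃ = E₃)
    (iF₁ : F₁ * F₁ = F₁) (iF₂ : F₂ * F₂ = F₂) (iF₃ : F₃ * F₃ = F₃)
    (k₁ : ρ * kron₃ F₁ E₂ E₃ = 0) (k₂ : ρ * kron₃ E₁ F₂ E₃ = 0) (k₃ : ρ * kron₃ E₁ E₂ F₃ = 0)
    (k₀ : ρ * kron₃ (1 - F₁) (1 - F₂) (1 - F₃) = 0) :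
    8 * expect ρ (kron₃ E₁ E₂ E₃) ≤ expect ρ 1 := by
  obtain ⟨s₁, Q₁, hs₁, h₁⟩ := exists_isAnglePair_decomposition hE₁ hF₁ iE₁ iF₁
  obtain ⟨s₂, Q₂, hs₂, h₂⟩ := exists_isAnglePair_decomposition hE₂ hF₂ iE₂ iF₂
  obtain ⟨s₃, Q₃, hs₃, h₃⟩ := exists_isAnglePair_decomposition hE₃ hF₃ iE₃ iF₃
  have one : (1 : Matrix (l × m × n) (l × m × n) ℂ)
      = kron₃ (∑ t ∈ s₁, Q₁ t) (∑ t ∈ s₂, Q₂ t) (∑ t ∈ s₃, Q₃ t) := by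
    rw [hs₁, hs₂, hs₃]; simp [kron₃]
  have split : kron₃ E₁ E₂ E₃
      = kron₃ (∑ t ∈ s₁, Q₁ t * E₁) (∑ t ∈ s₂, Q₂ t * E₂) (∑ t ∈ s₃, Q₃ t * E₃) := by
    simp only [← Finset.sum_mul, hs₁, hs₂, hs₃, one_mul]
  rw [one, split, kron₃_sum, kron₃_sum]
  simp only [map_sum, Finset.mul_sum]
  refine Finset.sum_le_sum fun i _ => Finset.sum_le_sum fun j _ => Finset.sum_le_sum fun k _ => ?_
  obtain ⟨ce₁, cf₁, h₁⟩ := h₁ i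
  obtain ⟨ce₂, cf₂, h₂⟩ := h₂ j
  obtain ⟨ce₃, cf₃, h₃⟩ := h₃ k
  -- Since the block projections commute with the operators, every constraint restricts to every
  -- triple of blocks.
  have cut : ∀ {A : Matrix l l ℂ} {B : Matrix m m ℂ} {C : Matrix n n ℂ},
      Commute (Q₁ i) A → Commute (Q₂ j) B → Commute (Q₃ k) C → ρ * kron₃ A B C = 0 →
      ρ * kron₃ (Q₁ i * A) (Q₂ j * B) (Q₃ k * C) = 0 := fun hA hB hC h => by
    rw [hA.eq, hB.eq, hC.eq, ← kron₃_mul, ← mul_assoc, h, zero_mul]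
  refine expect_le_of_isAnglePair hρ h₁ h₂ h₃ (cut cf₁ ce₂ ce₃ k₁) (cut ce₁ cf₂ ce₃ k₂)
    (cut ce₁ ce₂ cf₃ k₃) ?_
  have := cut ((Commute.one_right _).sub_right cf₁) ((Commute.one_right _).sub_right cf₂)
    ((Commute.one_right _).sub_right cf₃) k₀
  simpa only [mul_sub, mul_one] using this

theorem expect_mono (hρ : ρ.PosSemidef) {X Y : Matrix (l × m × n) (l × m × n) ℂ} (h : X ≤ Y) :
    expect ρ X ≤ expect ρ Y := by
  have := expect_nonneg hρ (le_iff.mp h)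
  rwa [map_sub, sub_nonneg] at this

/-- If a product of effects has probability zero, so has the product of projections
dominated by multiples of them. -/
theorem mul_kron₃_eq_zero (hρ : ρ.PosSemidef) {A P : Matrix l l ℂ} {B R : Matrix m m ℂ}
    {C T : Matrix n n ℂ} {a b c : ℝ} (ha : 0 < a) (hb : 0 < b) (hc : 0 < c)
    (hA : a • P ≤ A) (hB : b • R ≤ B) (hC : c • T ≤ C)
    (hP : P.IsHermitian) (hR : R.IsHermitian) (hT : T.IsHermitian)
    (iP : P * P = P) (iR : R * R = R) (iT : T * T = T)
    (h : expect ρ (kron₃ A B C) = 0) : ρ * kron₃ P R T = 0 := by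
  have pP := (posSemidef_of_projection hP iP).nonneg
  have pR := (posSemidef_of_projection hR iR).nonneg
  have pT := (posSemidef_of_projection hT iT).nonneg
  have qP : 0 ≤ a • P := smul_nonneg ha.le pP
  have qR : 0 ≤ b • R := smul_nonneg hb.le pR
  have qT : 0 ≤ c • T := smul_nonneg hc.le pT
  refine mul_eq_zero_of_expect_eq_zero hρ (kron₃_isHermitian hP hR hT)
    (by rw [kron₃_mul, iP, iR, iT]) (le_antisymm ?_ ?_)
  · have h' := expect_mono hρ (kron₃_le_kron₃ hA hB hC (qP.trans hA) qR (qR.trans hB) qT)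
    rw [h] at h'
    have e : kron₃ (a • P) (b • R) (c • T) = (a * (b * c)) • kron₃ P R T := by
      simp only [kron₃, smul_kronecker, kronecker_smul, smul_smul]
      congr 1; ring
    rw [e, map_smul, smul_eq_mul] at h'
    exact nonpos_of_mul_nonpos_right h' (by positivity)
  · exact expect_nonneg hρ (pP.posSemidef.kronecker (pR.posSemidef.kronecker pT.posSemidef))

/-- The Hardy bound for arbitrary effects. -/
theorem expect_le_of_effects (hρ : ρ.PosSemidef)
    {E₁ F₁ : Matrix l l ℂ} {E₂ F₂ : Matrix m m ℂ} {E₃ F₃ : Matrix n n ℂ}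
    (hE₁ : 0 ≤ E₁) (hE₂ : 0 ≤ E₂) (hE₃ : 0 ≤ E₃) (hF₁ : 0 ≤ F₁) (hF₂ : 0 ≤ F₂) (hF₃ : 0 ≤ F₃)
    (hE₁' : E₁ ≤ 1) (hE₂' : E₂ ≤ 1) (hE₃' : E₃ ≤ 1)
    (hF₁' : F₁ ≤ 1) (hF₂' : F₂ ≤ 1) (hF₃' : F₃ ≤ 1)
    (k₁ : expect ρ (kron₃ F₁ E₂ E₃) = 0) (k₂ : expect ρ (kron₃ E₁ F₂ E₃) = 0)
    (k₃ : expect ρ (kron₃ E₁ E₂ F₃) = 0)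
    (k₀ : expect ρ (kron₃ (1 - F₁) (1 - F₂) (1 - F₃)) = 0) :
    8 * expect ρ (kron₃ E₁ E₂ E₃) ≤ expect ρ 1 := by
  obtain ⟨P₁, p₁, hP₁, iP₁, pp₁, lP₁, uP₁⟩ := exists_support_projection hE₁ hE₁'
  obtain ⟨P₂, p₂, hP₂, iP₂, pp₂, lP₂, uP₂⟩ := exists_support_projection hE₂ hE₂'
  obtain ⟨P₃, p₃, hP₃, iP₃, pp₃, lP₃, uP₃⟩ := exists_support_projection hE₃ hE₃'
  obtain ⟨R₁, r₁, hR₁, iR₁, rr₁, lR₁, uR₁⟩ := exists_support_projection hF₁ hF₁'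
  obtain ⟨R₂, r₂, hR₂, iR₂, rr₂, lR₂, uR₂⟩ := exists_support_projection hF₂ hF₂'
  obtain ⟨R₃, r₃, hR₃, iR₃, rr₃, lR₃, uR₃⟩ := exists_support_projection hF₃ hF₃'
  -- Enlarging `F` to its support shrinks the complement, so the all-minus constraint survives with
  -- factor 1.
  have compl₁ : (1 : ℝ) • (1 - R₁) ≤ 1 - F₁ := by rw [one_smul]; exact sub_le_sub_left uR₁ 1
  have compl₂ : (1 : ℝ) • (1 - R₂) ≤ 1 - F₂ := by rw [one_smul]; exact sub_le_sub_left uR₂ 1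
  have compl₃ : (1 : ℝ) • (1 - R₃) ≤ 1 - F₃ := by rw [one_smul]; exact sub_le_sub_left uR₃ 1
  have hbound := expect_le_of_projections hρ hP₁ hP₂ hP₃ hR₁ hR₂ hR₃ iP₁ iP₂ iP₃ iR₁ iR₂ iR₃
    (mul_kron₃_eq_zero hρ rr₁ pp₂ pp₃ lR₁ lP₂ lP₃ hR₁ hP₂ hP₃ iR₁ iP₂ iP₃ k₁)
    (mul_kron₃_eq_zero hρ pp₁ rr₂ pp₃ lP₁ lR₂ lP₃ hP₁ hR₂ hP₃ iP₁ iR₂ iP₃ k₂)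
    (mul_kron₃_eq_zero hρ pp₁ pp₂ rr₃ lP₁ lP₂ lR₃ hP₁ hP₂ hR₃ iP₁ iP₂ iR₃ k₃)
    (mul_kron₃_eq_zero hρ one_pos one_pos one_pos compl₁ compl₂ compl₃
      (isHermitian_one.sub hR₁) (isHermitian_one.sub hR₂) (isHermitian_one.sub hR₃)
      (IsIdempotentElem.one_sub iR₁) (IsIdempotentElem.one_sub iR₂)
      (IsIdempotentElem.one_sub iR₃) k₀)
  have hmono := expect_mono hρ (kron₃_le_kron₃ uP₁ uP₂ uP₃ (hE₁.trans uP₁) hE₂ (hE₂.trans uP₂) hE₃)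
  linarith

end Bound

/-! ### The bound for realizations -/

theorem IsPOVM.neg_one_eq {d : ℕ} {E : ℤˣ → Matrix (Fin d) (Fin d) ℂ} (h : IsPOVM E) :
    E (-1) = 1 - E 1 := by
  rw [← h.2]; abel

theorem IsPOVM.le_one {d : ℕ} {E : ℤˣ → Matrix (Fin d) (Fin d) ℂ} (h : IsPOVM E) :
    E 1 ≤ 1 := by
  rw [le_iff, ← h.neg_one_eq]; exact h.1 _

theorem hardyProb_le {d₁ d₂ d₃ : ℕ} (R : Realization d₁ d₂ d₃) (h : R.ZeroConstraints) :
    R.hardyProb ≤ 1 / 8 := by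
  obtain ⟨k₁, k₂, k₃, k₀⟩ := h
  have h0 := expect_le_of_effects R.density.1
    ((R.povm₁ 0).1 1).nonneg ((R.povm₂ 0).1 1).nonneg ((R.povm₃ 0).1 1).nonneg
    ((R.povm₁ 1).1 1).nonneg ((R.povm₂ 1).1 1).nonneg ((R.povm₃ 1).1 1).nonneg
    (R.povm₁ 0).le_one (R.povm₂ 0).le_one (R.povm₃ 0).le_one
    (R.povm₁ 1).le_one (R.povm₂ 1).le_one (R.povm₃ 1).le_one
    k₁ k₂ k₃ (by
      rw [← (R.povm₁ 1).neg_one_eq, ← (R.povm₂ 1).neg_one_eq, ← (R.povm₃ 1).neg_one_eq]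
      exact k₀)
  rw [expect_apply, expect_apply, mul_one, R.density.2, Complex.one_re] at h0
  change (R.ρ * kron₃ _ _ _).trace.re ≤ 1 / 8
  linarith

/-! ### A three-qubit realization attaining 1/8 -/

/-- The projections of the optimal realization: onto `(1, 1)/√2` for the setting `0`, onto
`(1, 0)` for the setting `1`. -/
noncomputable def optimalProjection (x : Fin 2) : Matrix (Fin 2) (Fin 2) ℂ :=
  if x = 0 then !![1 / 2, 1 / 2; 1 / 2, 1 / 2] else !![1, 0; 0, 0]

/-- The measurements of the optimal realization. -/
noncomputable def optimalMeasurement (x : Fin 2) (a : ℤˣ) : Matrix (Fin 2) (Fin 2) ℂ :=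
  if a = 1 then optimalProjection x else 1 - optimalProjection x

/-- The vector `(-|000⟩ + |011⟩ + |101⟩ + |110⟩) / 2`. -/
noncomputable def optimalVector : Fin 2 × Fin 2 × Fin 2 → ℂ := fun p =>
  ![!![-1 / 2, 0; 0, 1 / 2], !![0, 1 / 2; 1 / 2, 0]] p.1 p.2.1 p.2.2

theorem star_optimalVector : star optimalVector = optimalVector := by
  ext ⟨i, j, k⟩
  fin_cases i <;> fin_cases j <;> fin_cases k <;> simp [optimalVector]

theorem optimalMeasurement_isProjective (x : Fin 2) : IsProjective (optimalMeasurement x) := by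
  have hherm : (optimalProjection x).IsHermitian := by
    fin_cases x <;> ext i j <;> fin_cases i <;> fin_cases j <;> simp [optimalProjection]
  have hidem : optimalProjection x * optimalProjection x = optimalProjection x := by
    fin_cases x <;> ext i j <;> fin_cases i <;> fin_cases j <;>
      norm_num [optimalProjection, Matrix.mul_apply]
  refine ⟨fun a => ?_, by simp [optimalMeasurement]⟩
  unfold optimalMeasurement
  split
  · exact ⟨hherm, hidem⟩
  · exact ⟨isHermitian_one.sub hherm, IsIdempotentElem.one_sub hidem⟩

theorem IsProjective.isPOVM {d : ℕ} {E : ℤˣ → Matrix (Fin d) (Fin d) ℂ} (h : IsProjective E) :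
    IsPOVM E :=
  ⟨fun a => posSemidef_of_projection (h.1 a).1 (h.1 a).2, h.2⟩

/-- A three-qubit realization with the largest Hardy probability. -/
noncomputable def optimalRealization : Realization 2 2 2 where
  ρ := vecMulVec optimalVector (star optimalVector)
  A₁ := optimalMeasurement
  A₂ := optimalMeasurement
  A₃ := optimalMeasurement
  density := by
    refine ⟨posSemidef_vecMulVec_self_star _, ?_⟩
    rw [star_optimalVector]
    simp [trace_vecMulVec, dotProduct, Fintype.sum_prod_type, optimalVector]
    norm_num
  povm₁ x := (optimalMeasurement_isProjective x).isPOVM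
  povm₂ x := (optimalMeasurement_isProjective x).isPOVM
  povm₃ x := (optimalMeasurement_isProjective x).isPOVM

theorem optimalRealization_prob (a₁ a₂ a₃ : ℤˣ) (x₁ x₂ x₃ : Fin 2) :
    optimalRealization.prob a₁ a₂ a₃ x₁ x₂ x₃ =
      (optimalVector ⬝ᵥ kron₃ (optimalMeasurement x₁ a₁) (optimalMeasurement x₂ a₂)
        (optimalMeasurement x₃ a₃) *ᵥ optimalVector).re := by
  rw [Realization.prob, trace_mul_comm]
  simp only [optimalRealization]
  rw [mul_vecMulVec, trace_vecMulVec, dotProduct_comm, star_optimalVector]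

theorem optimalRealization_zeroConstraints : optimalRealization.ZeroConstraints := by
  refine ⟨?_, ?_, ?_, ?_⟩ <;> rw [optimalRealization_prob] <;>
    simp [dotProduct, mulVec, Fintype.sum_prod_type, optimalVector, optimalMeasurement,
      optimalProjection] <;> norm_num

theorem optimalRealization_hardyProb : optimalRealization.hardyProb = 1 / 8 := by
  rw [Realization.hardyProb, optimalRealization_prob]
  simp [dotProduct, mulVec, Fintype.sum_prod_type, optimalVector, optimalMeasurement,
      optimalProjection]
  norm_num

/-! ### Embedding qubits in larger dimensions -/

section Embedding

variable {d : ℕ}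

/-- The isometry of `ℂ²` onto the first two coordinates of `ℂᵈ`. -/
def qubitIsometry (h : 2 ≤ d) : Matrix (Fin d) (Fin 2) ℂ :=
  (1 : Matrix (Fin d) (Fin d) ℂ).submatrix id (Fin.castLE h)

theorem qubitIsometry_conjTranspose_mul_self (h : 2 ≤ d) :
    (qubitIsometry h)ᴴ * qubitIsometry h = 1 := by
  ext i j
  simp [qubitIsometry, Matrix.mul_apply, Matrix.one_apply, Fin.castLE_inj, eq_comm]

/-- The measurement on `ℂᵈ` that extends one on the image of the qubit by the outcome `-1`. -/
noncomputable def embedMeasurement (h : 2 ≤ d) (E : ℤˣ → Matrix (Fin 2) (Fin 2) ℂ) (a : ℤˣ) :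
    Matrix (Fin d) (Fin d) ℂ :=
  qubitIsometry h * E a * (qubitIsometry h)ᴴ
    + if a = 1 then 0 else 1 - qubitIsometry h * (qubitIsometry h)ᴴ

theorem embedMeasurement_isPOVM (h : 2 ≤ d) {E : ℤˣ → Matrix (Fin 2) (Fin 2) ℂ}
    (hE : IsPOVM E) : IsPOVM (embedMeasurement h E) := by
  have hV := qubitIsometry_conjTranspose_mul_self h
  constructor
  · intro a
    refine ((hE.1 a).mul_mul_conjTranspose_same _).add ?_
    split
    · exact PosSemidef.zero
    · refine posSemidef_of_projection (isHermitian_one.sub (isHermitian_mul_conjTranspose_self _))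
        (IsIdempotentElem.one_sub ?_)
      rw [IsIdempotentElem, Matrix.mul_assoc, ← Matrix.mul_assoc _ (qubitIsometry h), hV,
        Matrix.one_mul]
  · simp only [embedMeasurement, if_true, if_neg (show (-1 : ℤˣ) ≠ 1 by decide), add_zero]
    rw [← add_assoc, ← Matrix.add_mul, ← Matrix.mul_add, hE.2, Matrix.mul_one]
    abel

/-- The isometry `V` satisfies `Vᴴ V = 1`, so compression by `V` kills the added `1 - V Vᴴ`. This is
what preserves all joint probabilities. -/
theorem conjTranspose_mul_embedMeasurement_mul (h : 2 ≤ d)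
    (E : ℤˣ → Matrix (Fin 2) (Fin 2) ℂ) (a : ℤˣ) :
    (qubitIsometry h)ᴴ * embedMeasurement h E a * qubitIsometry h = E a := by
  have hV := qubitIsometry_conjTranspose_mul_self h
  have h0 : (qubitIsometry h)ᴴ * (if a = 1 then 0 else 1 - qubitIsometry h * (qubitIsometry h)ᴴ)
      * qubitIsometry h = 0 := by
    split
    · simp
    · rw [Matrix.mul_sub, Matrix.mul_one, ← Matrix.mul_assoc, hV, Matrix.one_mul, sub_self,
        Matrix.zero_mul]
  rw [embedMeasurement, Matrix.mul_add, Matrix.add_mul, h0, add_zero, Matrix.mul_assoc _ (E a),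
    ← Matrix.mul_assoc, hV, Matrix.one_mul, Matrix.mul_assoc, hV, Matrix.mul_one]

end Embedding

/-- A three-qubit realization seen in larger local dimensions. -/
noncomputable def embedRealization {d₁ d₂ d₃ : ℕ} (h₁ : 2 ≤ d₁) (h₂ : 2 ≤ d₂) (h₃ : 2 ≤ d₃)
    (R : Realization 2 2 2) : Realization d₁ d₂ d₃ where
  ρ := kron₃ (qubitIsometry h₁) (qubitIsometry h₂) (qubitIsometry h₃) * R.ρ *
    (kron₃ (qubitIsometry h₁) (qubitIsometry h₂) (qubitIsometry h₃))ᴴ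
  A₁ x := embedMeasurement h₁ (R.A₁ x)
  A₂ x := embedMeasurement h₂ (R.A₂ x)
  A₃ x := embedMeasurement h₃ (R.A₃ x)
  density := by
    refine ⟨R.density.1.mul_mul_conjTranspose_same _, ?_⟩
    rw [trace_mul_comm, ← Matrix.mul_assoc, kron₃, conjTranspose_kronecker, conjTranspose_kronecker,
      ← mul_kronecker_mul, ← mul_kronecker_mul, qubitIsometry_conjTranspose_mul_self,
      qubitIsometry_conjTranspose_mul_self, qubitIsometry_conjTranspose_mul_self,
      one_kronecker_one, one_kronecker_one, Matrix.one_mul, R.density.2]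
  povm₁ x := embedMeasurement_isPOVM h₁ (R.povm₁ x)
  povm₂ x := embedMeasurement_isPOVM h₂ (R.povm₂ x)
  povm₃ x := embedMeasurement_isPOVM h₃ (R.povm₃ x)

theorem embedRealization_prob {d₁ d₂ d₃ : ℕ} (h₁ : 2 ≤ d₁) (h₂ : 2 ≤ d₂) (h₃ : 2 ≤ d₃)
    (R : Realization 2 2 2) (a₁ a₂ a₃ : ℤˣ) (x₁ x₂ x₃ : Fin 2) :
    (embedRealization h₁ h₂ h₃ R).prob a₁ a₂ a₃ x₁ x₂ x₃ = R.prob a₁ a₂ a₃ x₁ x₂ x₃ := by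
  have h : ∀ (W : Matrix (Fin d₁ × Fin d₂ × Fin d₃) (Fin 2 × Fin 2 × Fin 2) ℂ)
      (X : Matrix (Fin d₁ × Fin d₂ × Fin d₃) (Fin d₁ × Fin d₂ × Fin d₃) ℂ),
      (W * R.ρ * Wᴴ * X).trace = (R.ρ * (Wᴴ * X * W)).trace := fun W X => by
    rw [Matrix.mul_assoc, Matrix.mul_assoc, trace_mul_comm, Matrix.mul_assoc]
  simp only [Realization.prob, embedRealization]
  rw [h]
  simp only [kron₃, conjTranspose_kronecker, ← mul_kronecker_mul,
    conjTranspose_mul_embedMeasurement_mul]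

theorem one_eighth_mem_hardyValues {d₁ d₂ d₃ : ℕ} (h₁ : 2 ≤ d₁) (h₂ : 2 ≤ d₂) (h₃ : 2 ≤ d₃) :
    1 / 8 ∈ hardyValues d₁ d₂ d₃ := by
  refine ⟨embedRealization h₁ h₂ h₃ optimalRealization, ?_, ?_⟩
  · simpa only [Realization.ZeroConstraints, embedRealization_prob] using
      optimalRealization_zeroConstraints
  · simpa only [Realization.hardyProb, embedRealization_prob] using optimalRealization_hardyProb

end TripartiteHardy

theorem theorem1 :
    IsGreatest TripartiteHardy.pureQubitHardyValues (1 / 8) ∧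
    IsGreatest TripartiteHardy.qubitHardyValues (1 / 8) ∧
    IsGreatest TripartiteHardy.finiteDimHardyValues (1 / 8) ∧
    ∀ d₁ d₂ d₃ : ℕ, 2 ≤ d₁ → 2 ≤ d₂ → 2 ≤ d₃ →
      IsGreatest (TripartiteHardy.hardyValues d₁ d₂ d₃) (1 / 8) := by
  open TripartiteHardy in
  have hproj : optimalRealization.Projective := ⟨optimalMeasurement_isProjective,
    optimalMeasurement_isProjective, optimalMeasurement_isProjective⟩
  refine ⟨⟨⟨optimalRealization, ⟨optimalVector, rfl⟩, hproj, optimalRealization_zeroConstraints,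
    optimalRealization_hardyProb⟩, ?_⟩, ⟨⟨optimalRealization, hproj,
    optimalRealization_zeroConstraints, optimalRealization_hardyProb⟩, ?_⟩,
    ⟨⟨2, 2, 2, one_eighth_mem_hardyValues le_rfl le_rfl le_rfl⟩, ?_⟩,
    fun d₁ d₂ d₃ h₁ h₂ h₃ => ⟨one_eighth_mem_hardyValues h₁ h₂ h₃, ?_⟩⟩
  · rintro _ ⟨R, -, -, h, rfl⟩
    exact hardyProb_le R h
  · rintro _ ⟨R, -, h, rfl⟩
    exact hardyProb_le R h
  · rintro _ ⟨d₁, d₂, d₃, R, h, rfl⟩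
    exact hardyProb_le R h
  · rintro _ ⟨R, h, rfl⟩
    exact hardyProb_le R h
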